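/- Let $n\ge 0$ and let $\hat G$ be the group, under composition, of formal diffeomorphisms of $(\mathbb C^n,0)$, i.e. of the $n$-tuples of formal power series in $n$ variables without constant term that are invertible for composition. Let $\hat G_0=\{h\in\hat G : D_0h=I\}$ be the subgroup of those tangent to the identity. For $m\ge 2$ let $\pi_m:\hat G\to\mathbb C^{d(m)}$ send $h$ to its $m$-jet, i.e. to the vector of the coefficients of the monomials of degree $1,\dots,m$ in the $n$ components of $h$ (so $d(m)=n\left(\binom{n+m}{n}-1\right)$). For $f,N\in\hat G$ let $$\hat G_0(f,N)=\{h\in\hat G_0 : h^{-1}\circ f\circ h=N\},\qquad \mathrm{Cent}(N)=\{h\in\hat G_0 : h\circ N=N\circ h\}.$$ An affine algebraic variety in $\mathbb C^d$ is a Zariski closed subset $V$ (possibly empty, not necessarily irreducible). It is smooth if its coordinate ring $\mathbb C[x_1,\dots,x_d]/I(V)$, where $I(V)$ is the ideal of all polynomials vanishing on $V$, is a smooth $\mathbb C$-algebra. **Proposition 1.1.** Let $f,N\in\hat G$ and $m\ge 2$. 1. $\pi_m(\hat G_0(f,N))$ is a smooth affine algebraic variety in $\mathbb C^{d(m)}$.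 2. If $\hat G_0(f,N)\neq\emptyset$, then $\pi_m(\hat G_0(f,N))$ is isomorphic, as an affine algebraic variety, to $\pi_m(\mathrm{Cent}(N))$. 3. $\pi_m(\mathrm{Cent}(N))$ is a smooth affine algebraic variety in $\mathbb C^{d(m)}$, and it carries a group structure with polynomial multiplication and inversion (so it is an affine algebraic group) for which $\pi_m:\mathrm{Cent}(N)\to\pi_m(\mathrm{Cent}(N))$ is a group homomorphism. -/

import Mathlib

/-! ### Formal maps and formal diffeomorphisms of `(ℂⁿ, 0)` -/

/-- A formal map `(ℂⁿ, 0) → (ℂⁿ, 0)`: an `n`-tuple of formal power series in `n` variables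
without constant terms. -/
@[ext]
structure FormalMap (n : ℕ) where
  comp : Fin n → MvPowerSeries (Fin n) ℂ
  constantCoeff_comp : ∀ i, MvPowerSeries.constantCoeff (comp i) = 0

namespace FormalMap

theorem hasSubst {n : ℕ} (F : FormalMap n) : MvPowerSeries.HasSubst F.comp :=
  MvPowerSeries.hasSubst_of_constantCoeff_zero F.constantCoeff_comp

/-- Formal maps form a monoid under composition: `F * G` is `F ∘ G`, i.e. the components of `G`
are substituted for the variables in those of `F`; the unit is the identity map. -/
noncomputable instance (n : ℕ) : Monoid (FormalMap n) where
  mul F G :=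
    { comp := fun i => MvPowerSeries.subst G.comp (F.comp i)
      constantCoeff_comp := fun i =>
        MvPowerSeries.constantCoeff_subst_eq_zero G.hasSubst G.constantCoeff_comp
          (F.constantCoeff_comp i) }
  one :=
    { comp := fun i => MvPowerSeries.X i
      constantCoeff_comp := fun i => MvPowerSeries.constantCoeff_X i }
  mul_assoc F G H := by
    apply FormalMap.ext
    funext i
    exact MvPowerSeries.subst_comp_subst_apply G.hasSubst H.hasSubst (F.comp i)
  one_mul F := by
    apply FormalMap.ext
    funext i
    exact MvPowerSeries.subst_X F.hasSubst i
  mul_one F := by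
    apply FormalMap.ext
    funext i
    exact congrFun (MvPowerSeries.subst_self (R := ℂ) (σ := Fin n)) (F.comp i)

theorem mul_comp {n : ℕ} (F G : FormalMap n) (i : Fin n) :
    (F * G).comp i = MvPowerSeries.subst G.comp (F.comp i) := rfl

theorem one_comp {n : ℕ} (i : Fin n) :
    (1 : FormalMap n).comp i = MvPowerSeries.X i := rfl

/-- The matrix of the linear part `D₀F`. -/
noncomputable def linearPart {n : ℕ} (F : FormalMap n) : Matrix (Fin n) (Fin n) ℂ :=
  Matrix.of fun i j => MvPowerSeries.coeff (Finsupp.single j 1) (F.comp i)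

theorem coeff_single_mul {n : ℕ} (f g : MvPowerSeries (Fin n) ℂ) (j : Fin n) :
    MvPowerSeries.coeff (Finsupp.single j 1) (f * g) =
      MvPowerSeries.constantCoeff f * MvPowerSeries.coeff (Finsupp.single j 1) g +
      MvPowerSeries.coeff (Finsupp.single j 1) f * MvPowerSeries.constantCoeff g := by
  classical
  rw [MvPowerSeries.coeff_mul, Finsupp.antidiagonal_single, Finset.sum_map,
    Finset.Nat.antidiagonal_succ]
  simp

/-- The chain rule for linear parts. -/
theorem linearPart_mul {n : ℕ} (F G : FormalMap n) :
    (F * G).linearPart = F.linearPart * G.linearPart := by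
  classical
  ext i j
  simp only [linearPart, Matrix.of_apply, Matrix.mul_apply, mul_comp]
  rw [MvPowerSeries.coeff_subst G.hasSubst]
  have hinj : Function.Injective (fun k : Fin n => (Finsupp.single k 1 : Fin n →₀ ℕ)) :=
    Finsupp.single_left_injective one_ne_zero
  rw [finsum_eq_sum_of_support_subset (s := Finset.univ.image
    (fun k : Fin n => (Finsupp.single k 1 : Fin n →₀ ℕ)))]
  · rw [Finset.sum_image (fun a _ b _ h => hinj h)]
    simp
  · intro d hd
    by_contra hd'
    apply hd
    by_cases h0 : d = 0
    · subst h0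
      simp [F.constantCoeff_comp i]
    obtain ⟨k, hk⟩ : ∃ k, d k ≠ 0 := by
      by_contra! hc
      exact h0 (Finsupp.ext hc)
    have hle : Finsupp.single k 1 ≤ d := by
      rw [Finsupp.single_le_iff]
      omega
    obtain ⟨e, rfl⟩ := exists_add_of_le hle
    have he : e ≠ 0 := by
      rintro rfl
      exact hd' (by simp)
    obtain ⟨l, hl⟩ : ∃ l, e l ≠ 0 := by
      by_contra! hc
      exact he (Finsupp.ext hc)
    have hce : MvPowerSeries.constantCoeff (e.prod fun s m => G.comp s ^ m) = 0 := by
      rw [Finsupp.prod, map_prod]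
      exact Finset.prod_eq_zero (Finsupp.mem_support_iff.2 hl)
        (by rw [map_pow, G.constantCoeff_comp, zero_pow hl])
    have hprod : (Finsupp.single k 1 + e).prod (fun s m => G.comp s ^ m) =
        G.comp k * e.prod fun s m => G.comp s ^ m := by
      rw [Finsupp.prod_add_index' (fun _ => pow_zero _) (fun _ _ _ => pow_add _ _ _),
        Finsupp.prod_single_index (h := fun s m => G.comp s ^ m) (pow_zero _), pow_one]
    beta_reduce
    rw [hprod, coeff_single_mul, hce, G.constantCoeff_comp]
    simp

theorem linearPart_one {n : ℕ} : (1 : FormalMap n).linearPart = 1 := by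
  classical
  ext i j
  simp [linearPart, one_comp, MvPowerSeries.coeff_X, Matrix.one_apply,
    Finsupp.single_left_inj (one_ne_zero : (1 : ℕ) ≠ 0), eq_comm]

/-- `F ↦ D₀F` as a homomorphism of monoids. -/
noncomputable def linearPartHom (n : ℕ) : FormalMap n →* Matrix (Fin n) (Fin n) ℂ where
  toFun := linearPart
  map_one' := linearPart_one
  map_mul' := linearPart_mul

end FormalMap

/-- The group `Ĝ` of formal diffeomorphisms of `(ℂⁿ, 0)`: the formal maps that are invertible
for composition.  The group law is composition and `h⁻¹` is the compositional inverse. -/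
abbrev FormalDiffeo (n : ℕ) : Type := (FormalMap n)ˣ

namespace FormalDiffeo

/-- The subgroup `Ĝ₀` of formal diffeomorphisms tangent to the identity, `D₀h = I`. -/
noncomputable def tangentToId (n : ℕ) : Subgroup (FormalDiffeo n) :=
  (Units.map (FormalMap.linearPartHom n)).ker

theorem mem_tangentToId {n : ℕ} (h : FormalDiffeo n) :
    h ∈ tangentToId n ↔ (h : FormalMap n).linearPart = 1 := by
  rw [tangentToId, MonoidHom.mem_ker, Units.ext_iff]
  rfl

/-- `Cent(N) = {h ∈ Ĝ₀ : h ∘ N = N ∘ h}`, as a subgroup of `Ĝ`. -/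
noncomputable def cent {n : ℕ} (N : FormalDiffeo n) : Subgroup (FormalDiffeo n) :=
  tangentToId n ⊓ Subgroup.centralizer {N}

theorem mem_cent {n : ℕ} (N h : FormalDiffeo n) :
    h ∈ cent N ↔ h ∈ tangentToId n ∧ h * N = N * h := by
  rw [cent, Subgroup.mem_inf, Subgroup.mem_centralizer_singleton_iff]

/-- `Ĝ₀(f, N) = {h ∈ Ĝ₀ : h⁻¹ ∘ f ∘ h = N}`, the set of normalizations of `f`. -/
def normalizations {n : ℕ} (f N : FormalDiffeo n) : Set (FormalDiffeo n) :=
  {h | h ∈ tangentToId n ∧ h⁻¹ * f * h = N}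

end FormalDiffeo

/-! ### Jets -/

/-- The coordinates of an `m`-jet at `0` of a formal map of `(ℂⁿ, 0)`: a component together with
a monomial of degree between `1` and `m`. -/
abbrev JetIndex (n m : ℕ) : Type :=
  Fin n × {α : Fin n →₀ ℕ // 1 ≤ α.degree ∧ α.degree ≤ m}

instance (n m : ℕ) : Finite (JetIndex n m) := by
  have : Finite {α : Fin n →₀ ℕ // 1 ≤ α.degree ∧ α.degree ≤ m} :=
    ((Finsupp.finite_of_degree_le (σ := Fin n) m).subset fun _ h => h.2).to_subtype
  infer_instance

/-- The `m`-jet `π_m(h)`, a point of the affine space `ℂ^{d(m)}` whose coordinates are indexed by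
`JetIndex n m`. -/
noncomputable def FormalDiffeo.jet {n : ℕ} (m : ℕ) (h : FormalDiffeo n) : JetIndex n m → ℂ :=
  fun p => MvPowerSeries.coeff p.2.1 ((h : FormalMap n).comp p.1)

/-! ### Affine algebraic varieties in complex affine space -/

/-- `V ⊆ ℂ^σ` is an affine algebraic variety: the set of common zeros of a family of
polynomials. -/
def IsAffineVariety {σ : Type} (V : Set (σ → ℂ)) : Prop :=
  ∃ I : Ideal (MvPolynomial σ ℂ), V = MvPolynomial.zeroLocus ℂ I

/-- The coordinate ring `ℂ[σ] / I(V)`, where `I(V)` is the ideal of all polynomials that vanish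
on `V`. -/
abbrev CoordinateRing {σ : Type} (V : Set (σ → ℂ)) : Type :=
  MvPolynomial σ ℂ ⧸ MvPolynomial.vanishingIdeal ℂ V

/-- `V ⊆ ℂ^σ` is a smooth (nonsingular) affine algebraic variety: it is Zariski closed and its
(reduced) coordinate ring is a smooth `ℂ`-algebra. -/
def IsSmoothAffineVariety {σ : Type} (V : Set (σ → ℂ)) : Prop :=
  IsAffineVariety V ∧ Algebra.Smooth ℂ (CoordinateRing V)

/-- A map between subsets of affine spaces is regular if it is given by polynomials in the
coordinates. -/
def IsRegularMap {σ τ : Type} {V : Set (σ → ℂ)} {W : Set (τ → ℂ)} (φ : V → W) : Prop :=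
  ∃ P : τ → MvPolynomial σ ℂ, ∀ (x : V) (j : τ), (φ x : τ → ℂ) j = MvPolynomial.eval x.1 (P j)

/-- `V` and `W` are isomorphic as affine algebraic varieties: there is a bijection that is
regular in both directions. -/
def IsomorphicVarieties {σ τ : Type} (V : Set (σ → ℂ)) (W : Set (τ → ℂ)) : Prop :=
  ∃ e : V ≃ W, IsRegularMap e ∧ IsRegularMap e.symm

/-- `V ⊆ ℂ^σ` with the given group structure is an affine algebraic group: `V` is Zariski closed,
and multiplication and inversion are given by polynomials in the coordinates. -/
structure IsAffineAlgebraicGroup {σ : Type} (V : Set (σ → ℂ)) [Group V] : Prop where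
  isAffineVariety : IsAffineVariety V
  regular_mul : ∃ P : σ → MvPolynomial (σ ⊕ σ) ℂ, ∀ (x y : V) (j : σ),
    (x * y).1 j = MvPolynomial.eval (Sum.elim x.1 y.1) (P j)
  regular_inv : IsRegularMap (fun x : V => x⁻¹)

/-! On `Ĝ₀` the condition `h ∘ N = N ∘ h` becomes linear in logarithmic coordinates. The exponential
is a bijection from the vector fields vanishing to order two at the origin onto `Ĝ₀`. Conjugating
the flow of `D` by `N` gives the flow of the conjugated field (`exp_conj_mul`), so by injectivity
`exp D` commutes with `N` exactly when `D` is invariant under `N` (`exp_mem_cent_iff`).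

The exponential is also triangular for the degree: a coefficient of degree `d + 1` of the flow is
that of the field plus a polynomial in coefficients of degree at most `d`
(`coeffsIn_flowComp_sub_fieldComp`). Hence exp and log act on `m`-jets by mutually inverse
polynomial maps. The `m`-jets of invariant fields form a finite-dimensional linear space, so
`π_m(Cent(N))` is the image of some `ℂʳ` under a polynomial map with a polynomial left inverse
(`isPolynomialRetract_jet_cent`). Such an image is Zariski closed and its coordinate ring is a
polynomial ring, hence smooth.

If `g` is one normalization, the set of all of them is the coset `g · Cent(N)`, and left composition
with `g` is a polynomial automorphism at the level of jets. Composition of jets is polynomial, and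
inversion on `Ĝ₀` is `exp D ↦ exp (-D)`, which gives the group structure. -/

open Finset

/-- Formal power series in `n` variables over `ℂ`. -/
abbrev FormalSeries (n : ℕ) : Type := MvPowerSeries (Fin n) ℂ

/-! ### The filtration of formal series by order of vanishing. -/

namespace FormalSeries

variable {n : ℕ}

/-- The series all of whose coefficients of degree less than `k` vanish. -/
noncomputable def vanishing (n k : ℕ) : Submodule ℂ (FormalSeries n) where
  carrier := {f | ∀ α : Fin n →₀ ℕ, α.degree < k → MvPowerSeries.coeff α f = 0}
  zero_mem' := fun α _ => by simp
  add_mem' := fun hf hg α hα => by rw [map_add, hf α hα, hg α hα, add_zero]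
  smul_mem' := fun c f hf α hα => by rw [map_smul, hf α hα, smul_zero]

theorem vanishing_anti {k l : ℕ} (h : k ≤ l) : vanishing n l ≤ vanishing n k :=
  fun _ hf α hα => hf α (hα.trans_le h)

theorem mem_vanishing_zero (f : FormalSeries n) : f ∈ vanishing n 0 :=
  fun _ h => absurd h (Nat.not_lt_zero _)

theorem mem_vanishing_one {f : FormalSeries n} :
    f ∈ vanishing n 1 ↔ MvPowerSeries.constantCoeff f = 0 := by
  constructor
  · intro h
    simpa using h 0 (by simp)
  · intro h α hα
    obtain rfl : α = 0 := (Finsupp.degree_eq_zero_iff α).1 (by omega)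
    simpa using h

theorem mul_mem_vanishing {k l : ℕ} {f g : FormalSeries n} (hf : f ∈ vanishing n k)
    (hg : g ∈ vanishing n l) : f * g ∈ vanishing n (k + l) := by
  classical
  intro α hα
  rw [MvPowerSeries.coeff_mul]
  refine sum_eq_zero fun p hp => ?_
  rw [HasAntidiagonal.mem_antidiagonal] at hp
  have h : p.1.degree + p.2.degree = α.degree := by rw [← hp, map_add]
  by_cases h1 : p.1.degree < k
  · rw [hf _ h1, zero_mul]
  · rw [hg _ (by omega), mul_zero]

theorem pow_mem_vanishing {f : FormalSeries n} (hf : f ∈ vanishing n 1) (k : ℕ) :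
    f ^ k ∈ vanishing n k := by
  induction k with
  | zero => exact mem_vanishing_zero _
  | succ k ih => rw [pow_succ]; exact mul_mem_vanishing ih hf

theorem prod_mem_vanishing {a : Fin n → FormalSeries n} (ha : ∀ i, a i ∈ vanishing n 1)
    (d : Fin n →₀ ℕ) : d.prod (fun s e => a s ^ e) ∈ vanishing n d.degree := by
  classical
  rw [Finsupp.degree_apply, Finsupp.prod]
  induction d.support using Finset.induction_on with
  | empty => exact mem_vanishing_zero _
  | insert s t hs ih =>
    rw [prod_insert hs, sum_insert hs]
    exact mul_mem_vanishing (pow_mem_vanishing (ha s) _) ih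

theorem sub_truncTotal_mem_vanishing (f : FormalSeries n) (k : ℕ) :
    f - (MvPowerSeries.truncTotal k f : MvPolynomial (Fin n) ℂ) ∈ vanishing n k := by
  intro α hα
  rw [map_sub, MvPolynomial.coeff_coe, MvPowerSeries.coeff_truncTotal f hα, sub_self]

theorem eq_of_forall_sub_mem_vanishing {f g : FormalSeries n}
    (h : ∀ k, f - g ∈ vanishing n k) : f = g := by
  ext α
  simpa [sub_eq_zero] using h (α.degree + 1) α (Nat.lt_succ_self _)

/-- The operator `L` increases the order of vanishing at `0` by at least `j`. -/
def Raises (j : ℕ) (L : FormalSeries n →ₗ[ℂ] FormalSeries n) : Prop :=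
  ∀ k, ∀ f ∈ vanishing n k, L f ∈ vanishing n (k + j)

theorem Raises.mono {i j : ℕ} (h : i ≤ j) {L : FormalSeries n →ₗ[ℂ] FormalSeries n}
    (hL : Raises j L) : Raises i L :=
  fun k f hf => vanishing_anti (by omega) (hL k f hf)

theorem Raises.pow {L : FormalSeries n →ₗ[ℂ] FormalSeries n} (hL : Raises 1 L) (j : ℕ) :
    Raises j (L ^ j) := by
  induction j with
  | zero => exact fun k f hf => hf
  | succ j ih =>
    intro k f hf
    rw [pow_succ', Module.End.mul_apply]
    exact hL _ _ (ih k f hf)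

/-- Two filtered operators that agree on polynomials are equal. -/
theorem Raises.ext {L M : FormalSeries n →ₗ[ℂ] FormalSeries n} (hL : Raises 0 L)
    (hM : Raises 0 M) (h : ∀ p : MvPolynomial (Fin n) ℂ, L p = M p) : L = M := by
  refine LinearMap.ext fun f => eq_of_forall_sub_mem_vanishing fun k => ?_
  -- `L` and `M` agree on the truncation of `f`, so only the tail of order `k` contributes to the
  -- difference.
  have e : L f - M f = L (f - (MvPowerSeries.truncTotal k f : MvPolynomial (Fin n) ℂ)) -
      M (f - (MvPowerSeries.truncTotal k f : MvPolynomial (Fin n) ℂ)) := by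
    rw [map_sub, map_sub, h]; abel
  rw [e]
  exact Submodule.sub_mem _ (hL k _ (sub_truncTotal_mem_vanishing f k))
    (hM k _ (sub_truncTotal_mem_vanishing f k))

theorem raises_substAlgHom {a : Fin n → FormalSeries n}
    (ha : ∀ i, MvPowerSeries.constantCoeff (a i) = 0) :
    Raises 0 (MvPowerSeries.substAlgHom (R := ℂ)
      (MvPowerSeries.hasSubst_of_constantCoeff_zero ha)).toLinearMap := by
  intro k f hf α hα
  rw [AlgHom.toLinearMap_apply, MvPowerSeries.substAlgHom_apply,
    MvPowerSeries.coeff_subst (MvPowerSeries.hasSubst_of_constantCoeff_zero ha)]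
  refine finsum_eq_zero_of_forall_eq_zero fun d => ?_
  by_cases hd : d.degree < k
  · rw [hf d hd, zero_smul]
  · rw [prod_mem_vanishing (fun i => mem_vanishing_one.2 (ha i)) d α (by omega), smul_zero]

/-! ### Power series in an operator that raises the order of vanishing -/

/-- `φ(L) = ∑ φₖ Lᵏ`, which makes sense when `L` increases the order of vanishing. -/
noncomputable def powerSeriesOp (L : FormalSeries n →ₗ[ℂ] FormalSeries n) (φ : PowerSeries ℂ) :
    FormalSeries n →ₗ[ℂ] FormalSeries n where
  -- Stopping at `k = α.degree` loses nothing when `L` raises the order, since `L ^ k` then has no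
  -- coefficient of degree below `k`; it also keeps the sum finite for arbitrary `L`.
  toFun f := fun α => ∑ k ∈ range (α.degree + 1),
    PowerSeries.coeff k φ * MvPowerSeries.coeff α ((L ^ k) f)
  map_add' f g := by
    funext α
    change _ = (∑ k ∈ range (α.degree + 1),
      PowerSeries.coeff k φ * MvPowerSeries.coeff α ((L ^ k) f)) +
      ∑ k ∈ range (α.degree + 1), PowerSeries.coeff k φ * MvPowerSeries.coeff α ((L ^ k) g)
    simp only [map_add, mul_add, sum_add_distrib]
  map_smul' c f := by
    funext α
    change _ = c * ∑ k ∈ range (α.degree + 1),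
      PowerSeries.coeff k φ * MvPowerSeries.coeff α ((L ^ k) f)
    simp only [map_smul, smul_eq_mul, mul_sum]
    exact sum_congr rfl fun _ _ => by ring

theorem coeff_powerSeriesOp (L : FormalSeries n →ₗ[ℂ] FormalSeries n) (φ : PowerSeries ℂ)
    (f : FormalSeries n) (α : Fin n →₀ ℕ) :
    MvPowerSeries.coeff α (powerSeriesOp L φ f) = ∑ k ∈ range (α.degree + 1),
      PowerSeries.coeff k φ * MvPowerSeries.coeff α ((L ^ k) f) := rfl

section

variable {L : FormalSeries n →ₗ[ℂ] FormalSeries n}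

theorem coeff_pow_eq_zero (hL : Raises 1 L) {k : ℕ} {α : Fin n →₀ ℕ} (h : α.degree < k)
    (f : FormalSeries n) : MvPowerSeries.coeff α ((L ^ k) f) = 0 :=
  hL.pow k 0 f (mem_vanishing_zero f) α (by omega)

/-- Modulo series vanishing to order `K`, `φ(L)` is a polynomial in `L`. -/
theorem powerSeriesOp_sub_mem (hL : Raises 1 L) (φ : PowerSeries ℂ) (f : FormalSeries n)
    (K : ℕ) : powerSeriesOp L φ f - ∑ k ∈ range K, PowerSeries.coeff k φ • (L ^ k) f ∈
      vanishing n K := by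
  intro α hα
  rw [map_sub, map_sum, coeff_powerSeriesOp, sub_eq_zero]
  simp only [map_smul, smul_eq_mul]
  refine sum_subset (range_subset_range.2 hα) fun k _ hk => ?_
  rw [coeff_pow_eq_zero hL (by simpa using hk), mul_zero]

theorem raises_powerSeriesOp (hL : Raises 1 L) (φ : PowerSeries ℂ) :
    Raises 0 (powerSeriesOp L φ) := by
  intro k f hf α hα
  rw [coeff_powerSeriesOp]
  refine sum_eq_zero fun i _ => ?_
  rw [((hL.pow i).mono (Nat.zero_le i)) k f hf α hα, mul_zero]

/-- Regroups a square sum along antidiagonals, the corner beyond the main antidiagonal being zero.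
This is how truncated operator series are multiplied. -/
theorem sum_range_sum_range_eq {M : Type*} [AddCommMonoid M] (K : ℕ) (a : ℕ → ℕ → M)
    (ha : ∀ i j, K ≤ i + j → a i j = 0) :
    ∑ i ∈ range K, ∑ j ∈ range K, a i j =
      ∑ k ∈ range K, ∑ p ∈ antidiagonal k, a p.1 p.2 := by
  classical
  rw [← sum_product', sum_sigma']
  symm
  refine sum_of_injOn (fun x => (x.2.1, x.2.2)) ?_ ?_ ?_ ?_
  · rintro ⟨k, i, j⟩ hx ⟨k', i', j'⟩ hx' h
    simp only [coe_sigma, Set.mem_sigma_iff, mem_coe, mem_range, HasAntidiagonal.mem_antidiagonal,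
      Prod.mk.injEq] at hx hx' h
    obtain ⟨rfl, rfl⟩ := h
    obtain rfl : k = k' := by omega
    rfl
  · rintro ⟨k, i, j⟩ hx
    simp only [coe_sigma, Set.mem_sigma_iff, mem_coe, mem_range, HasAntidiagonal.mem_antidiagonal] at hx
    simp only [coe_product, Set.mem_prod, mem_coe, mem_range]
    omega
  · rintro ⟨i, j⟩ _ hij
    refine ha i j ?_
    by_contra! h
    exact hij ⟨⟨i + j, i, j⟩, by simpa using h, rfl⟩
  · rintro ⟨k, i, j⟩ _
    rfl

theorem powerSeriesOp_mul (hL : Raises 1 L) (φ ψ : PowerSeries ℂ) :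
    powerSeriesOp L (φ * ψ) = powerSeriesOp L φ * powerSeriesOp L ψ := by
  refine LinearMap.ext fun f => ?_
  ext α
  set K := α.degree + 1 with hK
  -- `L ^ i` preserves the filtration, so `ψ(L) f` may be replaced by its truncation at order `K`
  -- before reading the coefficient at `α`.
  have key : ∀ i, MvPowerSeries.coeff α ((L ^ i) (powerSeriesOp L ψ f)) =
      ∑ j ∈ range K, PowerSeries.coeff j ψ * MvPowerSeries.coeff α ((L ^ (i + j)) f) := by
    intro i
    have h := ((hL.pow i).mono (Nat.zero_le i)) K _ (powerSeriesOp_sub_mem hL ψ f K) α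
      (by omega)
    rw [map_sub, map_sub, sub_eq_zero] at h
    simp only [h, map_sum, map_smul, smul_eq_mul, pow_add, Module.End.mul_apply]
  rw [Module.End.mul_apply, coeff_powerSeriesOp, coeff_powerSeriesOp, ← hK]
  simp only [key, mul_sum]
  rw [sum_range_sum_range_eq]
  · refine sum_congr rfl fun k _ => ?_
    rw [PowerSeries.coeff_mul, sum_mul]
    refine sum_congr rfl fun p hp => ?_
    rw [← HasAntidiagonal.mem_antidiagonal.1 hp, mul_assoc]
  · intro i j hij
    rw [coeff_pow_eq_zero hL (by omega), mul_zero, mul_zero]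

theorem powerSeriesOp_one : powerSeriesOp L 1 = 1 := by
  refine LinearMap.ext fun f => ?_
  ext α
  rw [coeff_powerSeriesOp, sum_range_succ']
  simp [PowerSeries.coeff_one]

/-- If a filtered operator intertwines `L` and `M`, it intertwines `φ(L)` and `φ(M)`. -/
theorem powerSeriesOp_intertwine (hL : Raises 1 L) {M T : FormalSeries n →ₗ[ℂ] FormalSeries n}
    (hM : Raises 1 M) (hT : Raises 0 T) (h : T * L = M * T) (φ : PowerSeries ℂ) :
    T * powerSeriesOp L φ = powerSeriesOp M φ * T := by
  have hpow : ∀ k, T * L ^ k = M ^ k * T := fun k => SemiconjBy.pow_right h k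
  refine LinearMap.ext fun f => eq_of_forall_sub_mem_vanishing fun K => ?_
  have h1 := hT K _ (powerSeriesOp_sub_mem hL φ f K)
  have h2 := powerSeriesOp_sub_mem hM φ (T f) K
  have h3 : T (∑ k ∈ range K, PowerSeries.coeff k φ • (L ^ k) f) =
      ∑ k ∈ range K, PowerSeries.coeff k φ • (M ^ k) (T f) := by
    rw [map_sum]
    refine sum_congr rfl fun k _ => ?_
    rw [map_smul, ← Module.End.mul_apply, hpow, Module.End.mul_apply]
  rw [map_sub, h3] at h1
  simpa [Module.End.mul_apply] using Submodule.sub_mem _ h1 h2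

end

/-! ### Derivations -/

theorem pow_derivation_mul (D : Derivation ℂ (FormalSeries n) (FormalSeries n)) (k : ℕ)
    (f g : FormalSeries n) :
    ((D : FormalSeries n →ₗ[ℂ] FormalSeries n) ^ k) (f * g) = ∑ p ∈ antidiagonal k,
      k.choose p.1 • (((D : FormalSeries n →ₗ[ℂ] FormalSeries n) ^ p.1) f *
        ((D : FormalSeries n →ₗ[ℂ] FormalSeries n) ^ p.2) g) := by
  set L := (D : FormalSeries n →ₗ[ℂ] FormalSeries n) with hLdef
  induction k with
  | zero => simp
  | succ k ih =>
    rw [sum_antidiagonal_choose_succ_nsmul (fun i j => (L ^ i) f * (L ^ j) g) k, pow_succ',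
      Module.End.mul_apply, ih, map_sum, ← sum_add_distrib]
    refine sum_congr rfl fun ⟨i, j⟩ hij => ?_
    have h1 : ∀ u v, L (u * v) = u * L v + v * L u := fun u v => by
      simp [hLdef, D.leibniz]
    rw [map_nsmul, h1, k.choose_symm_of_eq_add (HasAntidiagonal.mem_antidiagonal.1 hij).symm, pow_succ', pow_succ',
      Module.End.mul_apply, Module.End.mul_apply, smul_add, mul_comm ((L ^ j) g)]

/-- The exponential of a derivation is multiplicative: the iterated Leibniz rule produces `choose (i
+ j) i`, and dividing it by `(i + j)!` leaves `1 / (i! j!)`. -/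
theorem powerSeriesOp_exp_mul (D : Derivation ℂ (FormalSeries n) (FormalSeries n))
    (hD : Raises 1 (D : FormalSeries n →ₗ[ℂ] FormalSeries n)) (f g : FormalSeries n) :
    powerSeriesOp (D : FormalSeries n →ₗ[ℂ] FormalSeries n) (PowerSeries.exp ℂ) (f * g) =
      powerSeriesOp (D : FormalSeries n →ₗ[ℂ] FormalSeries n) (PowerSeries.exp ℂ) f *
      powerSeriesOp (D : FormalSeries n →ₗ[ℂ] FormalSeries n) (PowerSeries.exp ℂ) g := by
  set L := (D : FormalSeries n →ₗ[ℂ] FormalSeries n) with hLdef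
  set E := powerSeriesOp L (PowerSeries.exp ℂ) with hE
  refine eq_of_forall_sub_mem_vanishing fun K => ?_
  set e : ℕ → ℂ := fun k => PowerSeries.coeff k (PowerSeries.exp ℂ) with he
  have hfg := powerSeriesOp_sub_mem hD (PowerSeries.exp ℂ) (f * g) K
  have hf := powerSeriesOp_sub_mem hD (PowerSeries.exp ℂ) f K
  have hg := powerSeriesOp_sub_mem hD (PowerSeries.exp ℂ) g K
  rw [← hE] at hfg hf hg
  set A := ∑ k ∈ range K, e k • (L ^ k) f with hA
  set B := ∑ k ∈ range K, e k • (L ^ k) g with hB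
  set C := ∑ k ∈ range K, e k • (L ^ k) (f * g) with hC
  have hCAB : C - A * B ∈ vanishing n K := by
    intro α hα
    rw [map_sub, sub_eq_zero, hC, hA, hB, sum_mul_sum, map_sum]
    simp only [map_sum]
    rw [sum_range_sum_range_eq]
    · refine sum_congr rfl fun k _ => ?_
      rw [pow_derivation_mul, smul_sum, map_sum]
      refine sum_congr rfl fun p hp => ?_
      have hp' := HasAntidiagonal.mem_antidiagonal.1 hp
      congr 1
      rw [smul_mul_smul_comm, ← Nat.cast_smul_eq_nsmul ℂ, smul_smul]
      congr 1
      simp only [he, PowerSeries.coeff_exp]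
      rw [← hp', Nat.choose_eq_factorial_div_factorial (Nat.le_add_right _ _), Nat.add_sub_cancel_left]
      have h := Nat.factorial_mul_factorial_dvd_factorial_add p.1 p.2
      rw [Nat.cast_div h (by
        exact_mod_cast Nat.mul_ne_zero (Nat.factorial_ne_zero _) (Nat.factorial_ne_zero _))]
      have h0 : ((p.1 + p.2).factorial : ℂ) ≠ 0 := by exact_mod_cast Nat.factorial_ne_zero _
      have h1 : (p.1.factorial : ℂ) ≠ 0 := by exact_mod_cast Nat.factorial_ne_zero _
      have h2 : (p.2.factorial : ℂ) ≠ 0 := by exact_mod_cast Nat.factorial_ne_zero _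
      simp
      field_simp
    · intro i j hij
      have h1 := (hD.pow i) 0 f (mem_vanishing_zero f)
      have h2 := (hD.pow j) 0 g (mem_vanishing_zero g)
      rw [smul_mul_smul_comm, map_smul, mul_mem_vanishing h1 h2 α (by omega), smul_zero]
  -- Every group of terms on the right is a truncation error of order `K`.
  have key : E (f * g) - E f * E g =
      (E (f * g) - C) + (C - A * B) - ((E f - A) * E g + A * (E g - B)) := by ring
  rw [key]
  refine Submodule.sub_mem _ (Submodule.add_mem _ hfg hCAB) (Submodule.add_mem _ ?_ ?_)
  · exact mul_mem_vanishing hf (mem_vanishing_zero _)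
  · simpa using mul_mem_vanishing (mem_vanishing_zero A) hg

/-- The Lie algebra of formal vector fields that vanish at `0` to order at least two, as a space
of derivations. -/
noncomputable def vectorFields (n : ℕ) :
    Submodule ℂ (Derivation ℂ (FormalSeries n) (FormalSeries n)) where
  carrier := {D | Raises 1 (D : FormalSeries n →ₗ[ℂ] FormalSeries n)}
  zero_mem' := fun _ _ _ => Submodule.zero_mem _
  add_mem' := fun hD hE k f hf => Submodule.add_mem _ (hD k f hf) (hE k f hf)
  smul_mem' := fun c _ hD k f hf => Submodule.smul_mem _ c (hD k f hf)

theorem derivation_coe (D : Derivation ℂ (FormalSeries n) (FormalSeries n))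
    (p : MvPolynomial (Fin n) ℂ) :
    D p = ∑ i, D (MvPowerSeries.X i) * MvPowerSeries.pderiv ℂ i (p : FormalSeries n) := by
  induction p using MvPolynomial.induction_on with
  | C a =>
    rw [MvPolynomial.coe_C]
    have : (MvPowerSeries.C a : FormalSeries n) = algebraMap ℂ _ a := rfl
    simp only [mul_zero, sum_const_zero, this, Derivation.map_algebraMap]
  | add p q hp hq =>
    simp only [MvPolynomial.coe_add, map_add, hp, hq, mul_add, sum_add_distrib]
  | mul_X p j hp =>
    classical
    simp only [MvPolynomial.coe_mul, MvPolynomial.coe_X, Derivation.leibniz, hp, smul_eq_mul,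
      mul_add, sum_add_distrib, MvPowerSeries.pderiv_X]
    congr 1
    · rw [sum_eq_single j]
      · simp [mul_comm]
      · intro i _ hij
        simp [hij.symm]
      · simp
    · rw [mul_sum]
      exact sum_congr rfl fun i _ => by ring

theorem pderiv_mem_vanishing {k : ℕ} {f : FormalSeries n} (hf : f ∈ vanishing n (k + 1))
    (i : Fin n) : MvPowerSeries.pderiv ℂ i f ∈ vanishing n k := by
  intro α hα
  rw [MvPowerSeries.coeff_pderiv, hf _ (by rw [map_add, Finsupp.degree_single]; omega), zero_mul]

/-- The derivation `∑ Xᵢ ∂ᵢ` with components `X`. -/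
noncomputable def ofComponents (X : Fin n → FormalSeries n) :
    Derivation ℂ (FormalSeries n) (FormalSeries n) :=
  ∑ i, X i • MvPowerSeries.pderiv ℂ i

theorem ofComponents_apply (X : Fin n → FormalSeries n) (f : FormalSeries n) :
    ofComponents X f = ∑ i, X i * MvPowerSeries.pderiv ℂ i f := by
  change Derivation.coeFnAddMonoidHom (ofComponents X) f = _
  rw [ofComponents, map_sum, Finset.sum_apply]
  rfl

theorem ofComponents_X (X : Fin n → FormalSeries n) (j : Fin n) :
    ofComponents X (MvPowerSeries.X j) = X j := by
  classical
  rw [ofComponents_apply, sum_eq_single j]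
  · simp
  · intro i _ hij
    rw [MvPowerSeries.pderiv_X_of_ne hij.symm, mul_zero]
  · simp

/-- A partial derivative costs one order and the coefficient `X i` gains two. At `k = 0` there is no
order to lose. -/
theorem ofComponents_mem {X : Fin n → FormalSeries n} (hX : ∀ i, X i ∈ vanishing n 2) :
    ofComponents X ∈ vectorFields n := by
  intro k f hf
  change ofComponents X f ∈ _
  rw [ofComponents_apply]
  refine Submodule.sum_mem _ fun i _ => ?_
  cases k with
  | zero => exact vanishing_anti (by omega) (mul_mem_vanishing (hX i) (mem_vanishing_zero _))
  | succ k =>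
    exact vanishing_anti (by omega) (mul_mem_vanishing (hX i) (pderiv_mem_vanishing hf i))

theorem X_mem_vanishing (i : Fin n) : (MvPowerSeries.X i : FormalSeries n) ∈ vanishing n 1 :=
  mem_vanishing_one.2 (MvPowerSeries.constantCoeff_X i)

theorem apply_X_mem_vanishing {D : Derivation ℂ (FormalSeries n) (FormalSeries n)}
    (hD : D ∈ vectorFields n) (i : Fin n) : D (MvPowerSeries.X i) ∈ vanishing n 2 :=
  hD 1 _ (X_mem_vanishing i)

/-- Both sides agree on polynomials by the Leibniz rule, and filtered operators are determined
there. -/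
theorem eq_ofComponents {D : Derivation ℂ (FormalSeries n) (FormalSeries n)}
    (hD : D ∈ vectorFields n) : D = ofComponents fun i => D (MvPowerSeries.X i) := by
  have h : (D : FormalSeries n →ₗ[ℂ] FormalSeries n) =
      (ofComponents fun i => D (MvPowerSeries.X i)) := by
    refine Raises.ext (Raises.mono (Nat.zero_le 1) hD) (Raises.mono (Nat.zero_le 1)
      (ofComponents_mem (apply_X_mem_vanishing hD))) fun p => ?_
    change D p = ofComponents _ (p : FormalSeries n)
    rw [derivation_coe, ofComponents_apply]
  exact Derivation.ext fun f => congrArg (fun T => T f) h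

theorem apply_eq_sum {D : Derivation ℂ (FormalSeries n) (FormalSeries n)}
    (hD : D ∈ vectorFields n) (f : FormalSeries n) :
    D f = ∑ i, D (MvPowerSeries.X i) * MvPowerSeries.pderiv ℂ i f := by
  conv_lhs => rw [eq_ofComponents hD]
  rw [ofComponents_apply]

theorem vectorFields_ext {D E : Derivation ℂ (FormalSeries n) (FormalSeries n)}
    (hD : D ∈ vectorFields n) (hE : E ∈ vectorFields n)
    (h : ∀ i, D (MvPowerSeries.X i) = E (MvPowerSeries.X i)) : D = E := by
  rw [eq_ofComponents hD, eq_ofComponents hE]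
  simp only [h]

end FormalSeries

/-! ### Formal maps acting on series by pullback. -/

namespace FormalMap

open FormalSeries

variable {n : ℕ}

/-- The pullback `φ ↦ φ ∘ F` of formal series. -/
noncomputable def pullback (F : FormalMap n) : FormalSeries n →ₐ[ℂ] FormalSeries n :=
  MvPowerSeries.substAlgHom F.hasSubst

theorem pullback_apply (F : FormalMap n) (f : FormalSeries n) :
    F.pullback f = MvPowerSeries.subst F.comp f :=
  MvPowerSeries.substAlgHom_apply F.hasSubst f

theorem pullback_X (F : FormalMap n) (i : Fin n) :
    F.pullback (MvPowerSeries.X i) = F.comp i :=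
  MvPowerSeries.substAlgHom_X F.hasSubst i

theorem mul_comp_eq_pullback (F G : FormalMap n) (i : Fin n) :
    (F * G).comp i = G.pullback (F.comp i) := by
  rw [mul_comp, pullback_apply]

theorem pullback_mul (F G : FormalMap n) (f : FormalSeries n) :
    (F * G).pullback f = G.pullback (F.pullback f) := by
  rw [pullback_apply, pullback_apply, pullback_apply]
  exact (MvPowerSeries.subst_comp_subst_apply F.hasSubst G.hasSubst f).symm

theorem pullback_one (f : FormalSeries n) : (1 : FormalMap n).pullback f = f := by
  rw [pullback_apply]
  exact congrFun (MvPowerSeries.subst_self (R := ℂ) (σ := Fin n)) f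

theorem raises_pullback (F : FormalMap n) : Raises 0 F.pullback.toLinearMap :=
  raises_substAlgHom F.constantCoeff_comp

theorem comp_mem_vanishing (F : FormalMap n) (i : Fin n) : F.comp i ∈ vanishing n 1 :=
  mem_vanishing_one.2 (F.constantCoeff_comp i)

end FormalMap

/-! ### Time-one flows of vector fields. -/

namespace FormalSeries

variable {n : ℕ}

theorem raises_vectorField (D : vectorFields n) :
    Raises 1 (D.1 : FormalSeries n →ₗ[ℂ] FormalSeries n) := D.2

/-- The operator `exp D` for a vector field `D` vanishing to order at least two. -/
noncomputable def expOp (D : vectorFields n) : FormalSeries n →ₗ[ℂ] FormalSeries n :=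
  powerSeriesOp (D.1 : FormalSeries n →ₗ[ℂ] FormalSeries n) (PowerSeries.exp ℂ)

theorem raises_expOp (D : vectorFields n) : Raises 0 (expOp D) :=
  raises_powerSeriesOp D.2 _

theorem expOp_mul (D : vectorFields n) (f g : FormalSeries n) :
    expOp D (f * g) = expOp D f * expOp D g :=
  powerSeriesOp_exp_mul D.1 D.2 f g

theorem expOp_one (D : vectorFields n) : expOp D 1 = 1 := by
  ext α
  rw [expOp, coeff_powerSeriesOp, sum_range_succ']
  simp [PowerSeries.coeff_exp, pow_succ]

/-- The signs of the powers of `-D` can be moved into the series, and then `exp(x) exp(-x) = 1` is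
an identity of power series in the single operator `D`. -/
theorem expOp_neg_apply_expOp (D : vectorFields n) (f : FormalSeries n) :
    expOp (-D) (expOp D f) = f := by
  have h : expOp (-D) = powerSeriesOp (D.1 : FormalSeries n →ₗ[ℂ] FormalSeries n)
      (PowerSeries.evalNegHom (PowerSeries.exp ℂ)) := by
    refine LinearMap.ext fun g => ?_
    ext α
    rw [expOp, coeff_powerSeriesOp, coeff_powerSeriesOp]
    refine sum_congr rfl fun k _ => ?_
    have e : (((-D : vectorFields n) : Derivation ℂ (FormalSeries n) (FormalSeries n)) :
        FormalSeries n →ₗ[ℂ] FormalSeries n) =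
        -((D.1 : FormalSeries n →ₗ[ℂ] FormalSeries n) : Module.End ℂ (FormalSeries n)) := rfl
    have e' := neg_pow (R := Module.End ℂ (FormalSeries n)) (D.1 : FormalSeries n →ₗ[ℂ] _) k
    rw [e, e', PowerSeries.evalNegHom, PowerSeries.coeff_rescale]
    rcases Nat.even_or_odd k with hk | hk
    · simp [hk.neg_one_pow]
    · simp [hk.neg_one_pow]
  rw [h, expOp, ← Module.End.mul_apply, ← powerSeriesOp_mul D.2, mul_comm,
    PowerSeries.exp_mul_exp_neg_eq_one, powerSeriesOp_one, Module.End.one_apply]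

/-- The time-one flow of a vector field, as a formal map. -/
noncomputable def expMap (D : vectorFields n) : FormalMap n where
  comp i := expOp D (MvPowerSeries.X i)
  constantCoeff_comp i := mem_vanishing_one.1 (raises_expOp D 1 _ (X_mem_vanishing i))

/-- By multiplicativity `expOp D` is an algebra homomorphism. It agrees with the pullback on
variables, hence on polynomials, hence everywhere since both are filtered. -/
theorem pullback_expMap (D : vectorFields n) (f : FormalSeries n) :
    (expMap D).pullback f = expOp D f := by
  let E : FormalSeries n →ₐ[ℂ] FormalSeries n :=
    AlgHom.ofLinearMap (expOp D) (expOp_one D) (expOp_mul D)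
  have h : (expMap D).pullback.comp (MvPolynomial.coeToMvPowerSeries.algHom ℂ) =
      E.comp (MvPolynomial.coeToMvPowerSeries.algHom ℂ) := by
    refine MvPolynomial.algHom_ext fun i => ?_
    simp only [AlgHom.comp_apply, MvPolynomial.coeToMvPowerSeries.algHom_apply]
    simp only [MvPolynomial.coe_X, Algebra.algebraMap_self, MvPowerSeries.map_id, RingHom.id_apply,
      FormalMap.pullback_X]
    rfl
  have h' : (expMap D).pullback.toLinearMap = expOp D := by
    refine Raises.ext (FormalMap.raises_pullback _) (raises_expOp D) fun p => ?_
    have hp := DFunLike.congr_fun h p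
    simpa [E, MvPolynomial.coeToMvPowerSeries.algHom_apply] using hp
  exact DFunLike.congr_fun h' f

theorem expMap_mul_expMap_neg (D : vectorFields n) : expMap D * expMap (-D) = 1 := by
  apply FormalMap.ext
  funext i
  rw [FormalMap.mul_comp_eq_pullback, pullback_expMap]
  exact expOp_neg_apply_expOp D _

theorem expMap_neg_mul_expMap (D : vectorFields n) : expMap (-D) * expMap D = 1 := by
  have h : expMap (-D) * expMap (- -D) = 1 := expMap_mul_expMap_neg (-D)
  rwa [show - -D = D from Subtype.ext (neg_neg D.1)] at h

end FormalSeries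

/-! ### The exponential in the group and conjugation of fields. -/

namespace FormalDiffeo

open FormalSeries

variable {n : ℕ}

/-- The exponential map from vector fields vanishing to order two to formal diffeomorphisms. -/
noncomputable def exp (D : vectorFields n) : FormalDiffeo n where
  val := expMap D
  inv := expMap (-D)
  val_inv := expMap_mul_expMap_neg D
  inv_val := expMap_neg_mul_expMap D

theorem exp_comp (D : vectorFields n) (i : Fin n) :
    (exp D : FormalMap n).comp i = expOp D (MvPowerSeries.X i) := rfl

theorem exp_neg (D : vectorFields n) : exp (-D) = (exp D)⁻¹ :=
  Units.ext rfl

theorem pullback_exp (D : vectorFields n) (f : FormalSeries n) :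
    (exp D : FormalMap n).pullback f = expOp D f := pullback_expMap D f

theorem expOp_sub_mem (D : vectorFields n) {k : ℕ} {f : FormalSeries n}
    (hf : f ∈ vanishing n k) : expOp D f - f ∈ vanishing n (k + 1) := by
  intro α hα
  rw [map_sub, expOp, coeff_powerSeriesOp, sum_range_succ']
  simp only [pow_zero, Module.End.one_apply, PowerSeries.coeff_exp]
  rw [sum_eq_zero, zero_add]
  · simp
  · intro i _
    rw [(((raises_vectorField D).pow (i + 1)).mono (by omega)) k f hf α hα, mul_zero]

theorem exp_mem_tangentToId (D : vectorFields n) : exp D ∈ tangentToId n := by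
  rw [mem_tangentToId, ← FormalMap.linearPart_one]
  ext i j
  have h := expOp_sub_mem D (X_mem_vanishing i) (Finsupp.single j 1) (by simp)
  rw [map_sub, sub_eq_zero] at h
  exact h

/-- The conjugate of a vector field by a formal diffeomorphism. -/
noncomputable def conj (N : FormalDiffeo n) (D : vectorFields n) : vectorFields n where
  val := Derivation.mk'
    ((N : FormalMap n).pullback.toLinearMap ∘ₗ (D.1 : FormalSeries n →ₗ[ℂ] FormalSeries n) ∘ₗ
      ((N⁻¹ : FormalDiffeo n) : FormalMap n).pullback.toLinearMap) fun f g => by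
    have h : ∀ u, (N : FormalMap n).pullback (((N⁻¹ : FormalDiffeo n) : FormalMap n).pullback u) =
        u := fun u => by
      rw [← FormalMap.pullback_mul, Units.inv_mul, FormalMap.pullback_one]
    simp [h]
  property := fun k f hf => FormalMap.raises_pullback _ _ _
    (D.2 _ _ (FormalMap.raises_pullback _ _ _ hf))

theorem conj_pullback (N : FormalDiffeo n) (D : vectorFields n) (f : FormalSeries n) :
    (conj N D).1 ((N : FormalMap n).pullback f) = (N : FormalMap n).pullback (D.1 f) := by
  change (N : FormalMap n).pullback (D.1 (((N⁻¹ : FormalDiffeo n) : FormalMap n).pullback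
    ((N : FormalMap n).pullback f))) = _
  rw [← FormalMap.pullback_mul, Units.mul_inv, FormalMap.pullback_one]

/-- Pullback by `N` intertwines `D` with its conjugate, so it intertwines their exponentials.
Pullback is contravariant, which puts `N` on the left of the conjugated flow. -/
theorem exp_conj_mul (N : FormalDiffeo n) (D : vectorFields n) :
    exp D * N = N * exp (conj N D) := by
  have h := powerSeriesOp_intertwine (L := (D.1 : FormalSeries n →ₗ[ℂ] _))
    (M := ((conj N D).1 : FormalSeries n →ₗ[ℂ] _))
    (T := (N : FormalMap n).pullback.toLinearMap) (raises_vectorField D) (raises_vectorField _)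
    (FormalMap.raises_pullback _)
    (LinearMap.ext fun f => (conj_pullback N D f).symm) (PowerSeries.exp ℂ)
  refine Units.ext (FormalMap.ext (funext fun i => ?_))
  rw [Units.val_mul, Units.val_mul, FormalMap.mul_comp_eq_pullback,
    FormalMap.mul_comp_eq_pullback, pullback_exp, exp_comp, ← FormalMap.pullback_X]
  exact DFunLike.congr_fun h (MvPowerSeries.X i)

/-- The vector fields invariant under `N`. -/
noncomputable def invariantFields (N : FormalDiffeo n) : Submodule ℂ (vectorFields n) where
  carrier := {D | ∀ f, D.1 ((N : FormalMap n).pullback f) = (N : FormalMap n).pullback (D.1 f)}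
  zero_mem' := fun f => by simp
  add_mem' := fun {D E} hD hE f => by
    have h := congrArg₂ (· + ·) (hD f) (hE f)
    simpa using h
  smul_mem' := fun c D hD f => by
    have h := congrArg (c • ·) (hD f)
    simpa using h

theorem mem_invariantFields {N : FormalDiffeo n} {D : vectorFields n} :
    D ∈ invariantFields N ↔ conj N D = D := by
  constructor
  · intro h
    refine Subtype.ext (Derivation.ext fun f => ?_)
    have h1 : (N : FormalMap n).pullback (((N⁻¹ : FormalDiffeo n) : FormalMap n).pullback f) =
        f := by
      rw [← FormalMap.pullback_mul, Units.inv_mul, FormalMap.pullback_one]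
    have h2 := h (((N⁻¹ : FormalDiffeo n) : FormalMap n).pullback f)
    rw [h1] at h2
    exact h2.symm
  · intro h f
    have h1 := conj_pullback N D f
    rwa [h] at h1

end FormalDiffeo

/-! ### Polynomial dependence on jets, and triangularity of the exponential. -/

namespace FormalSeries

variable {n : ℕ} {Y : Type}

theorem sum_fun_mem {ι : Type*} (A : Subalgebra ℂ (Y → ℂ)) (s : Finset ι) (F : ι → Y → ℂ)
    (h : ∀ i ∈ s, F i ∈ A) : (fun y => ∑ i ∈ s, F i y) ∈ A := by
  have e : (fun y => ∑ i ∈ s, F i y) = ∑ i ∈ s, F i := by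
    funext y
    rw [Finset.sum_apply]
  rw [e]
  exact Subalgebra.sum_mem _ h

theorem const_mem (A : Subalgebra ℂ (Y → ℂ)) (c : ℂ) : (fun _ => c) ∈ A :=
  A.algebraMap_mem c

/-- The coefficients of degree at most `m` of a family of series lie in `A`. -/
def CoeffsIn (A : Subalgebra ℂ (Y → ℂ)) (m : ℕ) (f : Y → FormalSeries n) : Prop :=
  ∀ α : Fin n →₀ ℕ, α.degree ≤ m → (fun y => MvPowerSeries.coeff α (f y)) ∈ A

theorem CoeffsIn.one (A : Subalgebra ℂ (Y → ℂ)) (m : ℕ) :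
    CoeffsIn A m fun _ => (1 : FormalSeries n) :=
  fun _ _ => const_mem A _

theorem CoeffsIn.mul {A : Subalgebra ℂ (Y → ℂ)} {m : ℕ} {f g : Y → FormalSeries n}
    (hf : CoeffsIn A m f) (hg : CoeffsIn A m g) : CoeffsIn A m fun y => f y * g y := by
  classical
  intro α hα
  simp only [MvPowerSeries.coeff_mul]
  refine sum_fun_mem A _ _ fun p hp => ?_
  have h : p.1.degree + p.2.degree = α.degree := by
    rw [← HasAntidiagonal.mem_antidiagonal.1 hp, map_add]
  exact A.mul_mem (hf _ (by omega)) (hg _ (by omega))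

theorem CoeffsIn.pow {A : Subalgebra ℂ (Y → ℂ)} {m : ℕ} {f : Y → FormalSeries n}
    (hf : CoeffsIn A m f) (k : ℕ) : CoeffsIn A m fun y => f y ^ k := by
  induction k with
  | zero => simpa only [pow_zero] using CoeffsIn.one A m
  | succ k ih => simpa only [pow_succ] using ih.mul hf

theorem CoeffsIn.prod {A : Subalgebra ℂ (Y → ℂ)} {m : ℕ} {ι : Type*} (s : Finset ι)
    {f : ι → Y → FormalSeries n} (hf : ∀ i ∈ s, CoeffsIn A m (f i)) :
    CoeffsIn A m fun y => ∏ i ∈ s, f i y := by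
  classical
  induction s using Finset.induction_on with
  | empty => simpa only [prod_empty] using CoeffsIn.one A m
  | insert i s his ih =>
    simp only [prod_insert his]
    exact (hf i (mem_insert_self _ _)).mul (ih fun j hj => hf j (mem_insert_of_mem hj))

/-- The jets of a composition depend polynomially on the jets of the factors. -/
theorem CoeffsIn.comp_mul {A : Subalgebra ℂ (Y → ℂ)} {m : ℕ} {F G : Y → FormalMap n}
    (hF : ∀ i, CoeffsIn A m fun y => (F y).comp i) (hG : ∀ i, CoeffsIn A m fun y => (G y).comp i)
    (i : Fin n) : CoeffsIn A m fun y => (F y * G y).comp i := by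
  intro α hα
  have e : (fun y => MvPowerSeries.coeff α ((F y * G y).comp i)) = fun y =>
      ∑ d ∈ (Finsupp.finite_of_degree_le (σ := Fin n) α.degree).toFinset,
        MvPowerSeries.coeff d ((F y).comp i) *
          MvPowerSeries.coeff α (d.prod fun s e => (G y).comp s ^ e) := by
    funext y
    rw [FormalMap.mul_comp, MvPowerSeries.coeff_subst (G y).hasSubst]
    refine finsum_eq_sum_of_support_subset _ fun d hd => ?_
    rw [Set.Finite.coe_toFinset]
    by_contra h
    refine hd ?_
    beta_reduce
    rw [prod_mem_vanishing (G y).comp_mem_vanishing d α (not_le.1 h), smul_zero]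
  rw [e]
  refine sum_fun_mem A _ _ fun d hd => A.mul_mem (hF i d ?_) ?_
  · exact le_trans (by simpa using hd) hα
  · exact CoeffsIn.prod d.support (fun s _ => (hG s).pow (d s)) α hα

/-- The functions of `y` that are polynomials in the `d`-jet of a family of tuples of series. -/
noncomputable def jetAlgebra (c : Y → Fin n → FormalSeries n) (d : ℕ) : Subalgebra ℂ (Y → ℂ) :=
  Algebra.adjoin ℂ (Set.range fun p : JetIndex n d => fun y =>
    MvPowerSeries.coeff p.2.1 (c y p.1))

theorem coeffsIn_jetAlgebra {c : Y → Fin n → FormalSeries n} (hc : ∀ y i, c y i ∈ vanishing n 1)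
    (d : ℕ) (i : Fin n) : CoeffsIn (jetAlgebra c d) d fun y => c y i := by
  intro α hα
  by_cases h : 1 ≤ α.degree
  · exact Algebra.subset_adjoin ⟨(i, ⟨α, h, hα⟩), rfl⟩
  · have e : (fun y => MvPowerSeries.coeff α (c y i)) = fun _ => 0 :=
      funext fun y => hc y i α (by omega)
    rw [e]
    exact const_mem _ 0

theorem jetAlgebra_mono (c : Y → Fin n → FormalSeries n) {d e : ℕ} (h : d ≤ e) :
    jetAlgebra c d ≤ jetAlgebra c e := by
  refine Algebra.adjoin_le ?_
  rintro _ ⟨p, rfl⟩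
  exact Algebra.subset_adjoin ⟨(p.1, ⟨p.2.1, p.2.2.1, p.2.2.2.trans h⟩), rfl⟩

/-- Polynomial dependence is handled as membership in a subalgebra of functions of the parameter;
explicit polynomials are extracted only here. -/
theorem exists_polynomial_of_mem_adjoin {ι : Type*} {g : ι → Y → ℂ} {F : Y → ℂ}
    (hF : F ∈ Algebra.adjoin ℂ (Set.range g)) :
    ∃ P : MvPolynomial ι ℂ, ∀ y, F y = MvPolynomial.eval (fun i => g i y) P := by
  rw [Algebra.adjoin_range_eq_range_aeval] at hF
  obtain ⟨P, rfl⟩ := hF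
  refine ⟨P, fun y => ?_⟩
  have h : (Pi.evalAlgHom ℂ (fun _ : Y => ℂ) y).comp (MvPolynomial.aeval g) =
      MvPolynomial.aeval fun i => g i y :=
    MvPolynomial.algHom_ext fun i => by simp
  rw [← MvPolynomial.coe_aeval_eq_eval]
  exact DFunLike.congr_fun h P

theorem eq_of_mem_jetAlgebra {c : Y → Fin n → FormalSeries n} {d : ℕ} {F : Y → ℂ}
    (hF : F ∈ jetAlgebra c d) {y z : Y} (h : ∀ p : JetIndex n d,
      MvPowerSeries.coeff p.2.1 (c y p.1) = MvPowerSeries.coeff p.2.1 (c z p.1)) :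
    F y = F z := by
  obtain ⟨P, hP⟩ := exists_polynomial_of_mem_adjoin hF
  rw [hP, hP]
  simp only [h]

/-- The components of a vector field. -/
noncomputable def fieldComp (D : vectorFields n) (i : Fin n) : FormalSeries n :=
  D.1 (MvPowerSeries.X i)

/-- The components of the time-one flow of a vector field. -/
noncomputable def flowComp (D : vectorFields n) (i : Fin n) : FormalSeries n :=
  expOp D (MvPowerSeries.X i)

theorem fieldComp_mem_vanishing (D : vectorFields n) (i : Fin n) :
    fieldComp D i ∈ vanishing n 2 := apply_X_mem_vanishing D.2 i

theorem coeffsIn_fieldComp (d : ℕ) (i : Fin n) :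
    CoeffsIn (jetAlgebra fieldComp d) d fun D : vectorFields n => fieldComp D i :=
  coeffsIn_jetAlgebra (fun D i => vanishing_anti one_le_two (fieldComp_mem_vanishing D i)) d i

theorem coeffsIn_flowComp (d : ℕ) (i : Fin n) :
    CoeffsIn (jetAlgebra flowComp d) d fun D : vectorFields n => flowComp D i :=
  coeffsIn_jetAlgebra (fun D i => raises_expOp D 1 _ (X_mem_vanishing i)) d i

/-- In `∑ Xᵢ ∂ᵢ g` the factor `Xᵢ` starts in degree 2 and `∂ᵢ g` in degree 1. For total degree at
most `d + 1`, this leaves only coefficients of `Xᵢ` and of `g` of degree at most `d`. -/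
theorem coeffsIn_apply {d : ℕ} {g : vectorFields n → FormalSeries n}
    (h2 : ∀ D, g D ∈ vanishing n 2) (hg : CoeffsIn (jetAlgebra fieldComp d) d g) :
    CoeffsIn (jetAlgebra fieldComp d) (d + 1) fun D => D.1 (g D) := by
  classical
  intro α hα
  have e : (fun D : vectorFields n => MvPowerSeries.coeff α (D.1 (g D))) = fun D => ∑ i,
      ∑ p ∈ antidiagonal α, MvPowerSeries.coeff p.1 (fieldComp D i) *
        (MvPowerSeries.coeff (p.2 + Finsupp.single i 1) (g D) * ((p.2 i : ℂ) + 1)) := by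
    funext D
    rw [apply_eq_sum D.2, map_sum]
    refine sum_congr rfl fun i _ => ?_
    rw [MvPowerSeries.coeff_mul]
    refine sum_congr rfl fun p _ => ?_
    rw [MvPowerSeries.coeff_pderiv]
    rfl
  rw [e]
  refine sum_fun_mem _ _ _ fun i _ => sum_fun_mem _ _ _ fun p hp => ?_
  have h : p.1.degree + p.2.degree = α.degree := by
    rw [← HasAntidiagonal.mem_antidiagonal.1 hp, map_add]
  have hdeg : (p.2 + Finsupp.single i 1).degree = p.2.degree + 1 := by
    rw [map_add, Finsupp.degree_single]
  by_cases hp1 : p.1.degree < 2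
  · convert const_mem (jetAlgebra fieldComp d) (0 : ℂ) using 2 with D
    rw [fieldComp_mem_vanishing D i _ hp1, zero_mul]
  by_cases hp2 : p.2.degree = 0
  · convert const_mem (jetAlgebra fieldComp d) (0 : ℂ) using 2 with D
    rw [h2 D _ (by omega), zero_mul, mul_zero]
  exact Subalgebra.mul_mem _ (coeffsIn_fieldComp d i _ (by omega))
    (Subalgebra.mul_mem _ (hg _ (by omega)) (const_mem _ _))

theorem coeffsIn_pow (k d : ℕ) (i : Fin n) :
    CoeffsIn (jetAlgebra fieldComp d) d fun D : vectorFields n =>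
      ((D.1 : FormalSeries n →ₗ[ℂ] FormalSeries n) ^ (k + 1)) (MvPowerSeries.X i) := by
  induction k with
  | zero => exact coeffsIn_fieldComp d i
  | succ k ih =>
    intro α hα
    simp only [pow_succ' _ (k + 1), Module.End.mul_apply]
    refine coeffsIn_apply (fun D => ?_) ih α (by omega)
    exact vanishing_anti (by omega)
      (((raises_vectorField D).pow (k + 1)) 1 _ (X_mem_vanishing i))

theorem coeffsIn_pow_succ (k d : ℕ) (i : Fin n) :
    CoeffsIn (jetAlgebra fieldComp d) (d + 1) fun D : vectorFields n =>
      ((D.1 : FormalSeries n →ₗ[ℂ] FormalSeries n) ^ (k + 2)) (MvPowerSeries.X i) := by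
  intro α hα
  simp only [pow_succ' _ (k + 1), Module.End.mul_apply]
  refine coeffsIn_apply (fun D => ?_) (coeffsIn_pow k d i) α hα
  exact vanishing_anti (by omega)
    (((raises_vectorField D).pow (k + 1)) 1 _ (X_mem_vanishing i))

theorem coeff_expOp (D : vectorFields n) (f : FormalSeries n) {α : Fin n →₀ ℕ} {K : ℕ}
    (hα : α.degree < K) : MvPowerSeries.coeff α (expOp D f) =
      ∑ k ∈ range K, PowerSeries.coeff k (PowerSeries.exp ℂ) *
        MvPowerSeries.coeff α (((D.1 : FormalSeries n →ₗ[ℂ] FormalSeries n) ^ k) f) := by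
  have h := powerSeriesOp_sub_mem (raises_vectorField D) (PowerSeries.exp ℂ) f K α hα
  rw [map_sub, sub_eq_zero, map_sum] at h
  simpa only [expOp, map_smul, smul_eq_mul] using h

/-- The exponential map is triangular: the coefficients of degree `d + 1` of the flow are those of
the field, up to polynomials in the coefficients of degree at most `d`. -/
theorem coeffsIn_flowComp_sub_fieldComp (d : ℕ) (i : Fin n) :
    CoeffsIn (jetAlgebra fieldComp d) (d + 1) fun D : vectorFields n =>
      flowComp D i - fieldComp D i := by
  intro α hα
  have e : (fun D : vectorFields n => MvPowerSeries.coeff α (flowComp D i - fieldComp D i)) =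
      fun D => (∑ k ∈ range d, PowerSeries.coeff (k + 2) (PowerSeries.exp ℂ) *
        MvPowerSeries.coeff α (((D.1 : FormalSeries n →ₗ[ℂ] FormalSeries n) ^ (k + 2))
          (MvPowerSeries.X i))) + MvPowerSeries.coeff α (MvPowerSeries.X i) := by
    funext D
    -- In degree at most `d + 1` only the powers below `d + 2` count. Powers 0 and 1 give `X i` and
    -- the field itself, so `d` nonlinear terms remain.
    rw [flowComp, map_sub, coeff_expOp D _ (show α.degree < d + 2 by omega), sum_range_succ',
      sum_range_succ']
    simp [PowerSeries.coeff_exp, fieldComp]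
    ring
  rw [e]
  refine Subalgebra.add_mem _ (sum_fun_mem _ _ _ fun k _ => ?_) (const_mem _ _)
  exact Subalgebra.mul_mem _ (const_mem _ _) (coeffsIn_pow_succ k d i α hα)

/-- Inverts the triangular system degree by degree: the logarithm is polynomial on jets. -/
theorem jetAlgebra_fieldComp_le (d : ℕ) :
    jetAlgebra (fieldComp (n := n)) d ≤ jetAlgebra flowComp d := by
  induction d with
  | zero =>
    refine Algebra.adjoin_le ?_
    rintro _ ⟨p, rfl⟩
    exact absurd (p.2.2.1.trans p.2.2.2) (by simp)
  | succ d ih =>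
    refine Algebra.adjoin_le ?_
    rintro _ ⟨p, rfl⟩
    have h1 := coeffsIn_flowComp (d + 1) p.1 p.2.1 p.2.2.2
    have h2 := jetAlgebra_mono flowComp (Nat.le_succ d)
      (ih (coeffsIn_flowComp_sub_fieldComp d p.1 p.2.1 p.2.2.2))
    refine Set.mem_of_eq_of_mem ?_ (Subalgebra.sub_mem _ h1 h2)
    funext D
    simp

theorem jetAlgebra_flowComp_le (d : ℕ) :
    jetAlgebra (flowComp (n := n)) d ≤ jetAlgebra fieldComp d := by
  refine Algebra.adjoin_le ?_
  rintro _ ⟨p, rfl⟩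
  have h1 := coeffsIn_fieldComp d p.1 p.2.1 p.2.2.2
  have h2 := coeffsIn_flowComp_sub_fieldComp d p.1 p.2.1 (p.2.2.2.trans (Nat.le_succ d))
  refine Set.mem_of_eq_of_mem ?_ (Subalgebra.add_mem _ h1 h2)
  funext D
  simp

theorem flowComp_injective : Function.Injective (flowComp (n := n)) := by
  intro D E h
  refine Subtype.ext (vectorFields_ext D.2 E.2 fun i => ?_)
  ext α
  exact eq_of_mem_jetAlgebra (jetAlgebra_fieldComp_le α.degree
    (coeffsIn_fieldComp α.degree i α le_rfl)) fun p => by rw [h]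

/-- A triangular system of equations is solvable. -/
theorem exists_solution_of_triangular {ι : Type*} (r : ι → ℕ) (T : (ι → ℂ) → ι → ℂ)
    (hT : ∀ x y i, (∀ j, r j < r i → x j = y j) → T x i = T y i) (h : ι → ℂ) :
    ∃ x : ι → ℂ, ∀ i, x i + T x i = h i := by
  classical
  -- Recursion on the rank. The default value 0 at indices of rank at least `r i` is harmless,
  -- because `T` at `i` does not see them.
  let x : ι → ℂ := (measure r).wf.fix fun i rec =>
    h i - T (fun j => if hj : r j < r i then rec j hj else 0) i
  refine ⟨x, fun i => ?_⟩
  have hx : x i = h i - T (fun j => if r j < r i then x j else 0) i := by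
    have := (measure r).wf.fix_eq (fun i (rec : ∀ j, r j < r i → ℂ) =>
      h i - T (fun j => if hj : r j < r i then rec j hj else 0) i) i
    refine this.trans ?_
    simp only [dite_eq_ite]
    rfl
  rw [hx, hT x (fun j => if r j < r i then x j else 0) i fun j hj => by rw [if_pos hj]]
  ring

end FormalSeries

/-! ### Bijectivity of the exponential, and the centralizer in logarithmic coordinates. -/

namespace FormalDiffeo

open FormalSeries

variable {n : ℕ}

theorem exp_injective : Function.Injective (exp (n := n)) := by
  intro D E h
  refine flowComp_injective (funext fun i => ?_)
  exact congrArg (fun F : FormalDiffeo n => (F : FormalMap n).comp i) h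

theorem exists_single_of_degree_eq_one {α : Fin n →₀ ℕ} (h : α.degree = 1) :
    ∃ j, α = Finsupp.single j 1 := by
  obtain ⟨j, hj⟩ : ∃ j, α j ≠ 0 := by
    by_contra! h0
    obtain rfl : α = 0 := Finsupp.ext h0
    simp at h
  obtain ⟨e, rfl⟩ := exists_add_of_le (Finsupp.single_le_iff.2 (Nat.one_le_iff_ne_zero.2 hj))
  rw [map_add, Finsupp.degree_single, Nat.add_eq_left, Finsupp.degree_eq_zero_iff] at h
  exact ⟨j, by rw [h, add_zero]⟩

/-- The exponential map is onto the formal diffeomorphisms tangent to the identity. -/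
theorem exists_exp_eq {h : FormalDiffeo n} (hh : h ∈ tangentToId n) :
    ∃ D : vectorFields n, exp D = h := by
  classical
  -- The unknowns are the coefficients of degree at least 2 of the field; those below are zero.
  let X : (Fin n × {α : Fin n →₀ ℕ // 2 ≤ α.degree} → ℂ) → Fin n → FormalSeries n :=
    fun x i α => if hα : 2 ≤ α.degree then x (i, ⟨α, hα⟩) else 0
  have hXc : ∀ x i (α : Fin n →₀ ℕ) (hα : 2 ≤ α.degree),
      MvPowerSeries.coeff α (X x i) = x (i, ⟨α, hα⟩) := fun x i α hα => dif_pos hα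
  have hX : ∀ x i, X x i ∈ vanishing n 2 := fun x i α hα => dif_neg (not_le.2 hα)
  let V : (Fin n × {α : Fin n →₀ ℕ // 2 ≤ α.degree} → ℂ) → vectorFields n :=
    fun x => ⟨ofComponents (X x), ofComponents_mem (hX x)⟩
  have hV : ∀ x i, fieldComp (V x) i = X x i := fun x i => ofComponents_X _ _
  obtain ⟨x, hx⟩ := exists_solution_of_triangular
    (fun q : Fin n × {α : Fin n →₀ ℕ // 2 ≤ α.degree} => q.2.1.degree)
    (fun x q => MvPowerSeries.coeff q.2.1 (flowComp (V x) q.1 - fieldComp (V x) q.1)) (by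
      rintro x y ⟨i, α, hα⟩ hxy
      refine eq_of_mem_jetAlgebra (coeffsIn_flowComp_sub_fieldComp (α.degree - 1) i α
        (by omega)) fun p => ?_
      rw [hV, hV]
      by_cases hp : 2 ≤ p.2.1.degree
      · rw [hXc _ _ _ hp, hXc _ _ _ hp]
        refine hxy _ ?_
        have := p.2.2.2
        change p.2.1.degree < α.degree
        omega
      · rw [hX x _ _ (not_le.1 hp), hX y _ _ (not_le.1 hp)])
    (fun q => MvPowerSeries.coeff q.2.1 ((h : FormalMap n).comp q.1))
  refine ⟨V x, Units.ext (FormalMap.ext (funext fun i => ?_))⟩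
  ext α
  by_cases h0 : α.degree = 0
  · rw [FormalMap.comp_mem_vanishing _ i α (by omega),
      FormalMap.comp_mem_vanishing _ i α (by omega)]
  -- The equations start in degree 2; in degree 1 both maps have linear part the identity.
  by_cases h1 : α.degree = 1
  · obtain ⟨j, rfl⟩ := exists_single_of_degree_eq_one h1
    have e := ((mem_tangentToId _).1 (exp_mem_tangentToId (V x))).trans
      ((mem_tangentToId h).1 hh).symm
    exact congrFun (congrFun e i) j
  have h2 : 2 ≤ α.degree := by omega
  have e := hx (i, ⟨α, h2⟩)
  rw [← hXc x i α h2, ← hV, map_sub, add_sub_cancel] at e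
  exact e

theorem exp_mem_cent_iff {N : FormalDiffeo n} {D : vectorFields n} :
    exp D ∈ cent N ↔ D ∈ invariantFields N := by
  rw [mem_cent, and_iff_right (exp_mem_tangentToId D), exp_conj_mul, mul_right_inj,
    exp_injective.eq_iff, mem_invariantFields]

end FormalDiffeo

/-! ### Polynomial retracts of affine space -/

section Varieties

open MvPolynomial

variable {σ τ : Type}

theorem aeval_apply_eq_eval (x : σ → ℂ) (g : MvPolynomial σ ℂ) : aeval x g = eval x g :=
  DFunLike.congr_fun (coe_aeval_eq_eval x) g

theorem eval_aeval (p : σ → MvPolynomial τ ℂ) (w : τ → ℂ) (g : MvPolynomial σ ℂ) :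
    eval w (aeval p g) = eval (fun s => eval w (p s)) g := by
  have h : (aeval w).comp (aeval p) = (aeval fun s => eval w (p s) : MvPolynomial σ ℂ →ₐ[ℂ] ℂ) :=
    algHom_ext fun i => by simp
  simpa [aeval_apply_eq_eval] using DFunLike.congr_fun h g

/-- The image of a polynomial map from `ℂʳ` that has a polynomial left inverse. -/
def IsPolynomialRetract (V : Set (σ → ℂ)) : Prop :=
  ∃ (r : ℕ) (p : σ → MvPolynomial (Fin r) ℂ) (q : Fin r → MvPolynomial σ ℂ),
    (∀ w i, eval (fun s => eval w (p s)) (q i) = w i) ∧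
    V = Set.range fun w s => eval w (p s)

/-- The image consists of the fixed points of `p ∘ q`, so it is closed. The comorphism of `p` is
onto because `q` is a left inverse, and its kernel is the ideal of the image, so the coordinate ring
is `ℂ[w₁, …, wᵣ]`. -/
theorem IsPolynomialRetract.isSmoothAffineVariety {V : Set (σ → ℂ)} (h : IsPolynomialRetract V) :
    IsSmoothAffineVariety V := by
  obtain ⟨r, p, q, hq, rfl⟩ := h
  constructor
  · refine ⟨Ideal.span (Set.range fun s => aeval q (p s) - X s), ?_⟩
    rw [zeroLocus_span]
    ext x
    simp only [Set.mem_range, Set.mem_ofPred_eq, forall_exists_index, forall_apply_eq_imp_iff,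
      aeval_apply_eq_eval, map_sub, eval_X, eval_aeval, sub_eq_zero]
    constructor
    · rintro ⟨w, rfl⟩ s
      simp only [hq]
    · exact fun hx => ⟨_, funext hx⟩
  · have hsurj : Function.Surjective (aeval p : MvPolynomial σ ℂ →ₐ[ℂ] MvPolynomial (Fin r) ℂ) := by
      rw [← AlgHom.range_eq_top, eq_top_iff, ← adjoin_range_X, Algebra.adjoin_le_iff]
      rintro _ ⟨i, rfl⟩
      exact ⟨q i, MvPolynomial.funext fun w => by
        simpa [hq] using eval_aeval p w (q i)⟩
    have hker : RingHom.ker (aeval p : MvPolynomial σ ℂ →ₐ[ℂ] MvPolynomial (Fin r) ℂ) =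
        vanishingIdeal ℂ (Set.range fun w s => eval w (p s)) := by
      ext g
      rw [RingHom.mem_ker, mem_vanishingIdeal_iff]
      simp only [Set.forall_mem_range, aeval_apply_eq_eval]
      constructor
      · intro hg w
        rw [← eval_aeval, hg, map_zero]
      · intro hg
        exact MvPolynomial.funext fun w => by rw [eval_aeval, hg, map_zero]
    have : Algebra.Smooth ℂ (MvPolynomial (Fin r) ℂ) := ⟨inferInstance, inferInstance⟩
    exact Algebra.Smooth.of_equiv ((Ideal.quotientKerAlgEquivOfSurjective hsurj).symm.trans
      (Ideal.quotientEquivAlgOfEq ℂ hker))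

theorem IsPolynomialRetract.image {V W : Set (σ → ℂ)} (h : IsPolynomialRetract V)
    (A B : σ → MvPolynomial σ ℂ) (hBA : ∀ x ∈ V, ∀ s, eval (fun t => eval x (A t)) (B s) = x s)
    (hW : W = (fun x s => eval x (A s)) '' V) : IsPolynomialRetract W := by
  obtain ⟨r, p, q, hq, rfl⟩ := h
  refine ⟨r, fun s => aeval p (A s), fun i => aeval B (q i), fun w i => ?_, ?_⟩
  · simp only [eval_aeval]
    rw [funext (hBA _ ⟨w, rfl⟩), hq]
  · rw [hW, ← Set.range_comp]
    simp only [eval_aeval]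
    rfl

/-- The coordinate ring is zero, which is the localization of `ℂ` away from `0`, hence smooth. -/
theorem isSmoothAffineVariety_empty : IsSmoothAffineVariety (∅ : Set (σ → ℂ)) := by
  refine ⟨⟨⊤, by simp⟩, ?_⟩
  have : Subsingleton (CoordinateRing (∅ : Set (σ → ℂ))) := by
    rw [CoordinateRing, vanishingIdeal_empty]
    exact Ideal.Quotient.subsingleton_iff.2 rfl
  have : IsLocalization.Away (0 : ℂ) (CoordinateRing (∅ : Set (σ → ℂ))) := by
    have e : Subsingleton (Localization.Away (0 : ℂ)) :=
      IsLocalization.subsingleton (M := Submonoid.powers (0 : ℂ)) (Submonoid.mem_powers _)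
    exact IsLocalization.isLocalization_of_algEquiv (Submonoid.powers (0 : ℂ))
      { toFun := fun _ : Localization.Away (0 : ℂ) => 0
        invFun := fun _ => 0
        left_inv := fun _ => Subsingleton.elim _ _
        right_inv := fun _ => Subsingleton.elim _ _
        map_mul' := fun _ _ => Subsingleton.elim _ _
        map_add' := fun _ _ => Subsingleton.elim _ _
        commutes' := fun _ => Subsingleton.elim _ _ }
  exact Algebra.Smooth.of_isLocalization_Away (0 : ℂ)

theorem exists_polynomial_of_linearMap {ι : Type} [Finite ι] (L : (ι → ℂ) →ₗ[ℂ] ℂ) :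
    ∃ P : MvPolynomial ι ℂ, ∀ x, eval x P = L x := by
  classical
  cases nonempty_fintype ι
  refine ⟨∑ i, C (L fun j => if i = j then 1 else 0) * X i, fun x => ?_⟩
  rw [LinearMap.pi_apply_eq_sum_univ L x]
  simp [mul_comm]

end Varieties

/-- A group structure descends along a surjection onto a set with compatible operations. -/
theorem exists_group_of_surjective {G V : Type*} [Group G] {J : G → V}
    (hJ : Function.Surjective J) {μ : V → V → V} {ν : V → V}
    (hμ : ∀ a b, μ (J a) (J b) = J (a * b)) (hν : ∀ a, ν (J a) = J a⁻¹) :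
    ∃ _ : Group V, (∀ x y : V, x * y = μ x y) ∧ (∀ x : V, x⁻¹ = ν x) ∧
      ∀ a b, J (a * b) = J a * J b := by
  let inst : Group V :=
    { mul := μ
      one := J 1
      inv := ν
      mul_assoc := fun x y z => by
        obtain ⟨a, rfl⟩ := hJ x
        obtain ⟨b, rfl⟩ := hJ y
        obtain ⟨c, rfl⟩ := hJ z
        change μ (μ (J a) (J b)) (J c) = μ (J a) (μ (J b) (J c))
        rw [hμ, hμ, hμ, hμ, mul_assoc]
      one_mul := fun x => by
        obtain ⟨a, rfl⟩ := hJ x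
        change μ (J 1) (J a) = J a
        rw [hμ, one_mul]
      mul_one := fun x => by
        obtain ⟨a, rfl⟩ := hJ x
        change μ (J a) (J 1) = J a
        rw [hμ, mul_one]
      inv_mul_cancel := fun x => by
        obtain ⟨a, rfl⟩ := hJ x
        change μ (ν (J a)) (J a) = J 1
        rw [hν, hμ, inv_mul_cancel] }
  exact ⟨inst, fun _ _ => rfl, fun _ => rfl, fun a b => (hμ a b).symm⟩

/-! ### Polynomial group operations on jets, and jets of the centralizer. -/

namespace FormalDiffeo

open FormalSeries MvPolynomial

variable {n : ℕ}

/-- The `m`-jet of a vector field. -/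
noncomputable def fieldJet (m : ℕ) (D : vectorFields n) : JetIndex n m → ℂ :=
  fun p => MvPowerSeries.coeff p.2.1 (fieldComp D p.1)

theorem exists_polynomial_exp (n m : ℕ) : ∃ E : JetIndex n m → MvPolynomial (JetIndex n m) ℂ,
    ∀ D p, jet m (exp D) p = eval (fieldJet m D) (E p) := by
  have h : ∀ p : JetIndex n m, ∃ P : MvPolynomial (JetIndex n m) ℂ,
      ∀ D, jet m (exp D) p = eval (fieldJet m D) P := fun p =>
    exists_polynomial_of_mem_adjoin (jetAlgebra_flowComp_le m
      (coeffsIn_flowComp m p.1 p.2.1 p.2.2.2))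
  choose E hE using h
  exact ⟨E, fun D p => hE p D⟩

theorem exists_polynomial_log (n m : ℕ) : ∃ Λ : JetIndex n m → MvPolynomial (JetIndex n m) ℂ,
    ∀ D p, fieldJet m D p = eval (jet m (exp D)) (Λ p) := by
  have h : ∀ p : JetIndex n m, ∃ P : MvPolynomial (JetIndex n m) ℂ,
      ∀ D, fieldJet m D p = eval (jet m (exp D)) P := fun p =>
    exists_polynomial_of_mem_adjoin (jetAlgebra_fieldComp_le m
      (coeffsIn_fieldComp m p.1 p.2.1 p.2.2.2))
  choose Λ hΛ using h
  exact ⟨Λ, fun D p => hΛ p D⟩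

theorem exists_polynomial_mul (n m : ℕ) :
    ∃ P : JetIndex n m → MvPolynomial (JetIndex n m ⊕ JetIndex n m) ℂ,
      ∀ (g h : FormalDiffeo n) p, jet m (g * h) p = eval (Sum.elim (jet m g) (jet m h)) (P p) := by
  let c : JetIndex n m ⊕ JetIndex n m → FormalDiffeo n × FormalDiffeo n → ℂ :=
    fun s y => Sum.elim (jet m y.1) (jet m y.2) s
  have h1 : ∀ i, CoeffsIn (Algebra.adjoin ℂ (Set.range c)) m
      fun y : FormalDiffeo n × FormalDiffeo n => (y.1 : FormalMap n).comp i := by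
    intro i α hα
    by_cases h : 1 ≤ α.degree
    · exact Algebra.subset_adjoin ⟨Sum.inl (i, ⟨α, h, hα⟩), rfl⟩
    · refine Set.mem_of_eq_of_mem ?_ (const_mem (Algebra.adjoin ℂ (Set.range c)) 0)
      exact funext fun y => FormalMap.comp_mem_vanishing _ i α (by omega)
  have h2 : ∀ i, CoeffsIn (Algebra.adjoin ℂ (Set.range c)) m
      fun y : FormalDiffeo n × FormalDiffeo n => (y.2 : FormalMap n).comp i := by
    intro i α hα
    by_cases h : 1 ≤ α.degree
    · exact Algebra.subset_adjoin ⟨Sum.inr (i, ⟨α, h, hα⟩), rfl⟩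
    · refine Set.mem_of_eq_of_mem ?_ (const_mem (Algebra.adjoin ℂ (Set.range c)) 0)
      exact funext fun y => FormalMap.comp_mem_vanishing _ i α (by omega)
  have h : ∀ p : JetIndex n m, ∃ P : MvPolynomial (JetIndex n m ⊕ JetIndex n m) ℂ,
      ∀ y : FormalDiffeo n × FormalDiffeo n, jet m (y.1 * y.2) p = eval (fun s => c s y) P :=
    fun p => exists_polynomial_of_mem_adjoin (CoeffsIn.comp_mul h1 h2 p.1 p.2.1 p.2.2.2)
  choose P hP using h
  exact ⟨P, fun g h p => hP p (g, h)⟩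

theorem exists_polynomial_mul_left (m : ℕ) (g : FormalDiffeo n) :
    ∃ A : JetIndex n m → MvPolynomial (JetIndex n m) ℂ,
      ∀ h p, eval (jet m h) (A p) = jet m (g * h) p := by
  obtain ⟨P, hP⟩ := exists_polynomial_mul n m
  refine ⟨fun p => aeval (Sum.elim (fun s => C (jet m g s)) X) (P p), fun h p => ?_⟩
  rw [eval_aeval, hP]
  congr 2
  funext s
  cases s <;> simp

/-- Inversion is exp after negation after log. Tangency to the identity provides the logarithm. -/
theorem exists_polynomial_inv (n m : ℕ) : ∃ Q : JetIndex n m → MvPolynomial (JetIndex n m) ℂ,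
    ∀ h ∈ tangentToId n, ∀ p, jet m h⁻¹ p = eval (jet m h) (Q p) := by
  obtain ⟨E, hE⟩ := exists_polynomial_exp n m
  obtain ⟨Λ, hΛ⟩ := exists_polynomial_log n m
  refine ⟨fun p => aeval (fun s => -Λ s) (E p), fun h hh p => ?_⟩
  obtain ⟨D, rfl⟩ := exists_exp_eq hh
  rw [← exp_neg, hE, eval_aeval]
  congr 2
  funext s
  rw [map_neg, ← hΛ]
  exact map_neg (MvPowerSeries.coeff s.2.1) (fieldComp D s.1)

/-- The jets of the centralizer of `N` are parametrized by the jets of the vector fields that are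
invariant under `N`. -/
theorem isPolynomialRetract_jet_cent (N : FormalDiffeo n) (m : ℕ) :
    IsPolynomialRetract (jet m '' (cent N : Set (FormalDiffeo n))) := by
  classical
  obtain ⟨E, hE⟩ := exists_polynomial_exp n m
  obtain ⟨Λ, hΛ⟩ := exists_polynomial_log n m
  let j : invariantFields N →ₗ[ℂ] (JetIndex n m → ℂ) :=
    { toFun := fun D => fieldJet m D.1
      map_add' := fun _ _ => funext fun p => map_add (MvPowerSeries.coeff p.2.1) _ _
      map_smul' := fun c _ => funext fun p => map_smul (MvPowerSeries.coeff p.2.1) c _ }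
  let b := Module.finBasis ℂ (LinearMap.range j)
  -- Linear coordinates on the space of jets of invariant fields; `π` below is a linear projection
  -- back to them.
  let ι := (LinearMap.range j).subtype ∘ₗ b.equivFun.symm.toLinearMap
  have hι : Function.Injective ι :=
    (LinearMap.range j).injective_subtype.comp b.equivFun.symm.injective
  obtain ⟨π, hπ⟩ := LinearMap.exists_leftInverse_of_injective ι (LinearMap.ker_eq_bot.2 hι)
  have hmem : ∀ w, ∃ D ∈ invariantFields N, fieldJet m D = ι w := fun w => by
    obtain ⟨D, hD⟩ := (b.equivFun.symm w).2
    exact ⟨D.1, D.2, hD⟩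
  choose a ha using fun s => exists_polynomial_of_linearMap
    ((LinearMap.proj s : (JetIndex n m → ℂ) →ₗ[ℂ] ℂ) ∘ₗ ι)
  choose c hc using fun i => exists_polynomial_of_linearMap
    ((LinearMap.proj i : (Fin _ → ℂ) →ₗ[ℂ] ℂ) ∘ₗ π)
  have ha' : ∀ w, (fun s => eval w (a s)) = ι w := fun w => funext fun s => ha s w
  have hexp : ∀ D w, fieldJet m D = ι w → (fun s => eval w (aeval a (E s))) = jet m (exp D) := by
    intro D w hD
    funext s
    rw [eval_aeval, ha', hE, hD]
  -- The parametrization is exp after `ι`; its left inverse is `π` after log.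
  refine ⟨_, fun s => aeval a (E s), fun i => aeval Λ (c i), fun w i => ?_, ?_⟩
  · obtain ⟨D, -, hD⟩ := hmem w
    rw [hexp D w hD, eval_aeval]
    simp only [← hΛ]
    rw [show (fun s => fieldJet m D s) = ι w from hD, hc]
    exact congrFun (DFunLike.congr_fun hπ w) i
  · ext x
    constructor
    · rintro ⟨h, hh, rfl⟩
      obtain ⟨D, rfl⟩ := exists_exp_eq ((mem_cent N h).1 hh).1
      refine ⟨b.equivFun ⟨fieldJet m D, ⟨D, exp_mem_cent_iff.1 hh⟩, rfl⟩, hexp D _ ?_⟩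
      simp [ι]
    · rintro ⟨w, rfl⟩
      obtain ⟨D, hD, hDw⟩ := hmem w
      exact ⟨exp D, exp_mem_cent_iff.2 hD, (hexp D w hDw).symm⟩

/-- Conjugating `f` by `g * h` is conjugating `N` by `h`, so the normalizations form a left coset of
the centralizer. -/
theorem mul_mem_normalizations_iff {f N g h : FormalDiffeo n} (hg : g ∈ normalizations f N) :
    g * h ∈ normalizations f N ↔ h ∈ cent N := by
  obtain ⟨hg1, hg2⟩ := hg
  have e : (g * h)⁻¹ * f * (g * h) = h⁻¹ * N * h := by
    rw [← hg2]
    group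
  rw [mem_cent, normalizations, Set.mem_ofPred_eq, e, Subgroup.mul_mem_cancel_left _ hg1, mul_assoc,
    inv_mul_eq_iff_eq_mul, eq_comm (a := N * h)]

end FormalDiffeo

/-! ### Translation by a normalization, and the group of jets. -/

theorem proposition1p1 (n : ℕ) (f N : FormalDiffeo n) (m : ℕ) (hm : 2 ≤ m) :
    IsSmoothAffineVariety (FormalDiffeo.jet m '' FormalDiffeo.normalizations f N) ∧
    ((FormalDiffeo.normalizations f N).Nonempty →
      IsomorphicVarieties
        (FormalDiffeo.jet m '' (FormalDiffeo.cent N : Set (FormalDiffeo n)))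
        (FormalDiffeo.jet m '' FormalDiffeo.normalizations f N)) ∧
    IsSmoothAffineVariety (FormalDiffeo.jet m '' (FormalDiffeo.cent N : Set (FormalDiffeo n))) ∧
    ∃ (_ : Group (FormalDiffeo.jet m '' (FormalDiffeo.cent N : Set (FormalDiffeo n))))
      (φ : FormalDiffeo.cent N →*
        (FormalDiffeo.jet m '' (FormalDiffeo.cent N : Set (FormalDiffeo n)))),
      IsAffineAlgebraicGroup
        (FormalDiffeo.jet m '' (FormalDiffeo.cent N : Set (FormalDiffeo n))) ∧
      ∀ h : FormalDiffeo.cent N,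
        (φ h : JetIndex n m → ℂ) = FormalDiffeo.jet m (h : FormalDiffeo n) := by
  have hcent := FormalDiffeo.isPolynomialRetract_jet_cent N m
  refine ⟨?_, ?_, hcent.isSmoothAffineVariety, ?_⟩
  · rcases (FormalDiffeo.normalizations f N).eq_empty_or_nonempty with h | ⟨g, hg⟩
    · rw [h, Set.image_empty]
      exact isSmoothAffineVariety_empty
    · obtain ⟨A, hA⟩ := FormalDiffeo.exists_polynomial_mul_left m g
      obtain ⟨B, hB⟩ := FormalDiffeo.exists_polynomial_mul_left m g⁻¹
      -- Left translation by `g` carries the jets of the centralizer onto those of the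
      -- normalizations, and translation by `g⁻¹` undoes it.
      refine (hcent.image A B ?_ ?_).isSmoothAffineVariety
      · rintro _ ⟨h, -, rfl⟩ s
        simp only [hA]
        exact (hB (g * h) s).trans (by rw [inv_mul_cancel_left])
      · ext x
        constructor
        · rintro ⟨h, hh, rfl⟩
          have hh' : g⁻¹ * h ∈ FormalDiffeo.cent N :=
            (FormalDiffeo.mul_mem_normalizations_iff hg).1 (by rwa [mul_inv_cancel_left])
          refine ⟨_, ⟨_, hh', rfl⟩, ?_⟩
          simp only [hA, mul_inv_cancel_left]
        · rintro ⟨_, ⟨h, hh, rfl⟩, rfl⟩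
          refine ⟨g * h, (FormalDiffeo.mul_mem_normalizations_iff hg).2 hh, ?_⟩
          simp only [hA]
  · rintro ⟨g, hg⟩
    obtain ⟨A, hA⟩ := FormalDiffeo.exists_polynomial_mul_left m g
    obtain ⟨B, hB⟩ := FormalDiffeo.exists_polynomial_mul_left m g⁻¹
    have hA' : ∀ h, (fun s => MvPolynomial.eval (FormalDiffeo.jet m h) (A s)) =
        FormalDiffeo.jet m (g * h) := fun h => funext (hA h)
    have hB' : ∀ h, (fun s => MvPolynomial.eval (FormalDiffeo.jet m h) (B s)) =
        FormalDiffeo.jet m (g⁻¹ * h) := fun h => funext (hB h)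
    refine ⟨
      { toFun := fun x => ⟨fun s => MvPolynomial.eval x.1 (A s), ?_⟩
        invFun := fun x => ⟨fun s => MvPolynomial.eval x.1 (B s), ?_⟩
        left_inv := ?_
        right_inv := ?_ }, ⟨A, fun _ _ => rfl⟩, ⟨B, fun _ _ => rfl⟩⟩
    · obtain ⟨_, h, hh, rfl⟩ := x
      exact ⟨g * h, (FormalDiffeo.mul_mem_normalizations_iff hg).2 hh, (hA' h).symm⟩
    · obtain ⟨_, h, hh, rfl⟩ := x
      exact ⟨g⁻¹ * h, (FormalDiffeo.mul_mem_normalizations_iff hg).1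
        (by rwa [mul_inv_cancel_left]), (hB' h).symm⟩
    · rintro ⟨_, h, hh, rfl⟩
      refine Subtype.ext ?_
      simp only [hA', hB', inv_mul_cancel_left]
    · rintro ⟨_, h, hh, rfl⟩
      refine Subtype.ext ?_
      simp only [hA', hB', mul_inv_cancel_left]
  · obtain ⟨P, hP⟩ := FormalDiffeo.exists_polynomial_mul n m
    obtain ⟨Q, hQ⟩ := FormalDiffeo.exists_polynomial_inv n m
    let J : FormalDiffeo.cent N →
        (FormalDiffeo.jet m '' (FormalDiffeo.cent N : Set (FormalDiffeo n))) :=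
      fun h => ⟨FormalDiffeo.jet m h.1, h.1, h.2, rfl⟩
    have hJ : Function.Surjective J := by
      rintro ⟨_, h, hh, rfl⟩
      exact ⟨⟨h, hh⟩, rfl⟩
    have hmul : ∀ a b : FormalDiffeo.cent N,
        (fun s => MvPolynomial.eval (Sum.elim (J a).1 (J b).1) (P s)) = (J (a * b)).1 :=
      fun a b => funext fun s => (hP a.1 b.1 s).symm
    have hinv : ∀ a : FormalDiffeo.cent N,
        (fun s => MvPolynomial.eval (J a).1 (Q s)) = (J a⁻¹).1 :=
      fun a => funext fun s => (hQ a.1 ((FormalDiffeo.mem_cent N a.1).1 a.2).1 s).symm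
    -- The polynomial operations stay inside the set of jets, and satisfy the group laws, because
    -- every point there lifts to the centralizer.
    obtain ⟨inst, h1, h2, h3⟩ := exists_group_of_surjective hJ
      (μ := fun x y => ⟨fun s => MvPolynomial.eval (Sum.elim x.1 y.1) (P s), by
        obtain ⟨a, rfl⟩ := hJ x
        obtain ⟨b, rfl⟩ := hJ y
        rw [hmul]
        exact (J (a * b)).2⟩)
      (ν := fun x => ⟨fun s => MvPolynomial.eval x.1 (Q s), by
        obtain ⟨a, rfl⟩ := hJ x
        rw [hinv]
        exact (J a⁻¹).2⟩)
      (fun a b => Subtype.ext (hmul a b)) (fun a => Subtype.ext (hinv a))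
    refine ⟨inst, MonoidHom.mk' J h3, ⟨hcent.isSmoothAffineVariety.1, ⟨P, fun x y s => ?_⟩,
      ⟨Q, fun x s => ?_⟩⟩, fun h => rfl⟩
    · rw [h1]
    · beta_reduce
      rw [h2]
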